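/- Let $G$ be a finite group and $M$ a maximal subgroup of $G$. A $c$-section of $M$ is a group $(M\cap K)/L$, where $K/L$ is a chief factor of $G$ (that is, $L<K$ are normal subgroups of $G$ with no normal subgroup of $G$ strictly between them) such that $L\le M$ and $K\not\le M$. The maximal subgroup $M$ has a $c$-section, unique up to isomorphism, and $\mathrm{Sec}(M)$ denotes the abstract group isomorphic to the $c$-sections of $M$; thus $\mathrm{Sec}(M)$ is supersolvable if and only if every $c$-section of $M$ is supersolvable. A group is supersolvable if it has a finite series of normal subgroups, from $1$ to the whole group, with cyclic factors. For every prime $p\equiv\pm1\pmod 8$, the group $\mathrm{PGL}_2(p)=\mathrm{GL}_2(\mathbb F_p)/Z(\mathrm{GL}_2(\mathbb F_p))$ is not solvable, and $\mathrm{Sec}(M)$ is supersolvable for every maximal subgroup $M$ of $\mathrm{PGL}_2(p)$. Consequently, the following question has a negative answer: if $G$ is a finite group such that $\mathrm{Sec}(M)$ is supersolvable for every maximal subgroup $M$ of $G$, must $G$ be solvable? -/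

import Mathlib

/-- `K / L` is a chief factor of `G`: `L < K` are normal subgroups of `G`, and no normal subgroup
of `G` lies strictly between them (that is, `K / L` is a minimal normal subgroup of `G / L`). -/
structure IsChiefFactor {G : Type*} [Group G] (K L : Subgroup G) : Prop where
  normal_top : K.Normal
  normal_bot : L.Normal
  lt : L < K
  eq_or_eq : ∀ N : Subgroup G, N.Normal → L ≤ N → N ≤ K → N = L ∨ N = K

/-- A group is supersolvable if it has a finite series `1 = H 0 ≤ H 1 ≤ … ≤ H n = G` of normal
subgroups of `G` with cyclic factors `H (i + 1) / H i`. (Values of `H` beyond `n` are irrelevant.) -/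
def IsSupersolvable (G : Type*) [Group G] : Prop :=
  ∃ (n : ℕ) (H : ℕ → Subgroup G) (_ : ∀ i, (H i).Normal),
    H 0 = ⊥ ∧ H n = ⊤ ∧
    ∀ i < n, H i ≤ H (i + 1) ∧ IsCyclic (↥(H (i + 1)) ⧸ (H i).subgroupOf (H (i + 1)))

/-- The chief factor `K / L` defines a c-section of `M`: `L ≤ M` while `K` is not contained
in `M`. -/
def DefinesCSection {G : Type*} [Group G] (M K L : Subgroup G) : Prop :=
  IsChiefFactor K L ∧ L ≤ M ∧ ¬ K ≤ M

/-- The group `(M ∩ K) / L`, for a normal subgroup `L` of `G` (used for `L ≤ M ∩ K`). -/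
abbrev CSection {G : Type*} [Group G] (M K L : Subgroup G) [L.Normal] : Type _ :=
  ↥(M ⊓ K) ⧸ L.subgroupOf (M ⊓ K)

/-- `Sec(M)` is supersolvable, where `Sec(M)` is the isomorphism type of the c-sections of `M`:
`M` has a c-section, and all c-sections of `M` are supersolvable. -/
def SecIsSupersolvable {G : Type*} [Group G] (M : Subgroup G) : Prop :=
  (∃ K L : Subgroup G, DefinesCSection M K L) ∧
  ∀ (K L : Subgroup G) [L.Normal], DefinesCSection M K L → IsSupersolvable (CSection M K L)

/-!
Write `S` for the image of `PSL₂(p)` in `G = PGL₂(p)`. Since `S` is simple with trivial centralizer,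
it is contained in every nontrivial normal subgroup of `G` (`pslSubgroup_le_of_normal`), and it has
index `2`. So `G` is not solvable, the c-sections of `S` are trivial, and a maximal subgroup `M ≠ S`
has `M ∩ S` as its only c-section. The point is that `M ∩ S` is metacyclic, that is,
cyclic-by-cyclic, hence supersolvable (`isMetacyclic_inf_pslSubgroup`).

If `M` has an element with a single eigenline, then `M` fixes that line and lies in a Borel
subgroup, as otherwise it contains two opposite root subgroups and with them `S`
(`le_stabilizer_or_pslSubgroup_le`). If not, every nontrivial element of `M` has exactly two fixed
points on the projective line over an algebraic closure, and point stabilizers are cyclic. Counting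
orbits as for the finite rotation groups (`exists_stabilizer_index_le_two`) leaves a cyclic subgroup
of index at most `2`, or `|M| ∈ {12, 24, 60}`.

No identification with `A₄`, `S₄`, `A₅` is needed. As `M` is not contained in `S`, the group `M ∩ S`
has order `|M| / 2`. Groups of the squarefree orders `6` and `30` have cyclic Sylow subgroups and
are therefore metacyclic. If `|M| = 24`, then `M` has an element of order `4`; it lies in `S`
because `2` is a square modulo `p` (`mem_pslSubgroup_of_orderOf_eq_four`), and this is where
`p ≡ ±1 mod 8` enters. A group of order `12` with an element of order `4` again has cyclic Sylow
subgroups.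
-/

/-! ### Metacyclic groups -/

/-- A group is *metacyclic* if it has a cyclic normal subgroup with cyclic quotient. -/
def IsMetacyclic (G : Type*) [Group G] : Prop :=
  ∃ (N : Subgroup G) (_ : N.Normal), IsCyclic N ∧ IsCyclic (G ⧸ N)

theorem IsMetacyclic.isSupersolvable {G : Type*} [Group G] (h : IsMetacyclic G) :
    IsSupersolvable G := by
  obtain ⟨N, hN, hc, hq⟩ := h
  let H : ℕ → Subgroup G := fun i => if i = 0 then ⊥ else if i = 1 then N else ⊤
  have hH : ∀ i, (H i).Normal := by
    intro i
    simp only [H]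
    split_ifs <;> infer_instance
  refine ⟨2, H, hH, rfl, rfl, ?_⟩
  intro i hi
  interval_cases i
  · refine ⟨bot_le, ?_⟩
    have : IsCyclic (H (0 + 1)) := hc
    exact isCyclic_of_surjective (QuotientGroup.mk' ((H 0).subgroupOf (H (0 + 1))))
      (QuotientGroup.mk'_surjective _)
  · refine ⟨le_top, ?_⟩
    let φ : G →* ↥(⊤ : Subgroup G) ⧸ N.subgroupOf ⊤ :=
      (QuotientGroup.mk' (N.subgroupOf ⊤)).comp Subgroup.topEquiv.symm.toMonoidHom
    have hφ : ∀ x ∈ N, φ x = 1 := fun x hx => by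
      simpa [φ, Subgroup.mem_subgroupOf] using! hx
    refine isCyclic_of_surjective (QuotientGroup.lift N φ hφ) ?_
    have hs : Function.Surjective φ := by
      rw [MonoidHom.coe_comp]
      exact (QuotientGroup.mk'_surjective _).comp Subgroup.topEquiv.symm.surjective
    exact QuotientGroup.lift_surjective_of_surjective _ _ hs _

theorem IsMetacyclic.of_surjective {G G' : Type*} [Group G] [Group G'] (h : IsMetacyclic G)
    (f : G →* G') (hf : Function.Surjective f) : IsMetacyclic G' := by
  obtain ⟨N, hN, hc, hq⟩ := h
  have hN' : (N.map f).Normal := hN.map f hf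
  refine ⟨N.map f, hN', ?_, ?_⟩
  · exact isCyclic_of_surjective (f.subgroupMap N) (f.subgroupMap_surjective N)
  · refine isCyclic_of_surjective (QuotientGroup.map N (N.map f) f (Subgroup.le_comap_map f N)) ?_
    exact QuotientGroup.map_surjective_of_surjective _ _ _
      ((QuotientGroup.mk'_surjective _).comp hf) _

theorem isMetacyclic_of_hom {G A : Type*} [Group G] [Group A] (f : G →* A)
    [IsCyclic f.ker] [IsCyclic f.range] : IsMetacyclic G :=
  ⟨f.ker, inferInstance, inferInstance,
    isCyclic_of_surjective (QuotientGroup.quotientKerEquivRange f).symm (MulEquiv.surjective _)⟩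

theorem isCyclic_of_forall_mem {G G' : Type*} [Group G] [Group G'] (f : G →* G')
    (hf : Function.Injective f) (C : Subgroup G') [IsCyclic C] (h : ∀ g, f g ∈ C) : IsCyclic G :=
  isCyclic_of_injective (f.codRestrict C h) ((MonoidHom.injective_codRestrict f C h).2 hf)

/-- The commutator subgroup and the abelianization of a finite Z-group are cyclic. -/
theorem isMetacyclic_of_isZGroup {G : Type*} [Group G] [Finite G] [IsZGroup G] :
    IsMetacyclic G :=
  ⟨commutator G, inferInstance, IsZGroup.isCyclic_commutator G,
    inferInstanceAs (IsCyclic (Abelianization G))⟩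

/-- A group of order `12` with an element of order `4` is a Z-group: all its Sylow subgroups are
cyclic. -/
theorem isZGroup_of_card_eq_twelve {G : Type*} [Group G] (hG : Nat.card G = 12) (g : G)
    (hg : orderOf g = 4) : IsZGroup G := by
  have : Finite G := Nat.finite_of_card_ne_zero (by omega)
  refine ⟨fun p hp P => ?_⟩
  have : Fact p.Prime := ⟨hp⟩
  have hcard := P.card_eq_multiplicity
  rw [hG] at hcard
  by_cases h2 : p = 2
  · subst h2
    have hz : IsPGroup 2 (Subgroup.zpowers g) :=
      IsPGroup.of_card (n := 2) (by rw [Nat.card_zpowers, hg]; rfl)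
    obtain ⟨Q, hQ⟩ := hz.exists_le_sylow
    have h4 : Nat.card P = 4 := by
      rw [hcard, Nat.factorization_def _ hp]
      have : padicValNat 2 12 = 2 := by
        rw [show (12 : ℕ) = 2 ^ 2 * 3 by norm_num, padicValNat.mul (by norm_num) (by norm_num),
          padicValNat.prime_pow]
        simp
      rw [this]; norm_num
    have hQ4 : Nat.card Q = 4 := by rw [← h4]; exact Nat.card_congr (Sylow.equiv Q P).toEquiv
    have hQc : IsCyclic Q := isCyclic_of_orderOf_eq_card ⟨g, hQ (Subgroup.mem_zpowers g)⟩
      (by rw [Subgroup.orderOf_mk, hg, hQ4])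
    exact isCyclic_of_surjective (Sylow.equiv Q P) (Sylow.equiv Q P).surjective
  · by_cases h3 : p = 3
    · subst h3
      have h3 : Nat.card P = 3 := by
        rw [hcard, Nat.factorization_def _ hp]
        have : padicValNat 3 12 = 1 := by
          rw [show (12 : ℕ) = 3 ^ 1 * 4 by norm_num, padicValNat.mul (by norm_num) (by norm_num),
            padicValNat.prime_pow, padicValNat.eq_zero_of_not_dvd (by norm_num)]
        rw [this]; norm_num
      exact isCyclic_of_prime_card (p := 3) h3
    · have h1 : Nat.card P = 1 := by
        rw [hcard, Nat.factorization_eq_zero_of_not_dvd, pow_zero]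
        intro hd
        have : p ∣ 2 ^ 2 * 3 := by simpa using hd
        rcases hp.dvd_mul.1 this with h | h
        · exact h2 ((Nat.prime_dvd_prime_iff_eq hp Nat.prime_two).1 (hp.dvd_of_dvd_pow h))
        · exact h3 ((Nat.prime_dvd_prime_iff_eq hp Nat.prime_three).1 h)
      have := (Nat.card_eq_one_iff_unique.1 h1).1
      infer_instance

/-! ### Finite groups whose nontrivial elements have two fixed points -/

/-- Among three orbits of sizes `mᵢ` with stabilizers of orders `e₁ ≤ e₂ ≤ e₃`, the equation
`1 / e₁ + 1 / e₂ + 1 / e₃ = 1 + 2 / n` forces `(e₁, e₂)` to be `(2, 2)`, where `m₃ = 2`, or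
`(2, 3)`, where `e₃` is `3`, `4` or `5`. -/
theorem burnside_ordered {n m₁ m₂ m₃ e₁ e₂ e₃ : ℕ} (h₁ : m₁ * e₁ = n) (h₂ : m₂ * e₂ = n)
    (h₃ : m₃ * e₃ = n) (he : 2 ≤ e₁) (h12 : e₁ ≤ e₂) (h23 : e₂ ≤ e₃)
    (hs : m₁ + m₂ + m₃ = n + 2) :
    m₃ ≤ 2 ∨ n = 12 ∨ (n = 24 ∧ e₃ = 4) ∨ n = 60 := by
  have hb : ∀ {m e k : ℕ}, k ≤ e → m * e = n → m * k ≤ n := fun hk h =>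
    h ▸ Nat.mul_le_mul_left _ hk
  have e1 : e₁ = 2 := by
    by_contra h
    have := hb (show 3 ≤ e₁ by omega) h₁
    have := hb (show 3 ≤ e₂ by omega) h₂
    have := hb (show 3 ≤ e₃ by omega) h₃
    omega
  subst e1
  have : e₂ < 4 := by
    by_contra h
    have := hb (show 4 ≤ e₂ by omega) h₂
    have := hb (show 4 ≤ e₃ by omega) h₃
    omega
  interval_cases e₂
  · left; omega
  · have : e₃ < 6 := by
      by_contra h
      have := hb (show 6 ≤ e₃ by omega) h₃
      omega
    interval_cases e₃ <;> omega

theorem burnside_three {n m₁ m₂ m₃ e₁ e₂ e₃ : ℕ} (h₁ : m₁ * e₁ = n) (h₂ : m₂ * e₂ = n)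
    (h₃ : m₃ * e₃ = n) (he₁ : 2 ≤ e₁) (he₂ : 2 ≤ e₂) (he₃ : 2 ≤ e₃)
    (hs : m₁ + m₂ + m₃ = n + 2) :
    (m₁ ≤ 2 ∨ m₂ ≤ 2 ∨ m₃ ≤ 2) ∨ n = 12 ∨ (n = 24 ∧ (e₁ = 4 ∨ e₂ = 4 ∨ e₃ = 4)) ∨ n = 60 := by
  rcases le_total e₁ e₂ with a | a <;> rcases le_total e₂ e₃ with b | b <;>
    rcases le_total e₁ e₃ with c | c
  · have := burnside_ordered h₁ h₂ h₃ he₁ a b (by omega); omega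
  · have := burnside_ordered h₁ h₂ h₃ he₁ a b (by omega); omega
  · have := burnside_ordered h₁ h₃ h₂ he₁ c b (by omega); omega
  · have := burnside_ordered h₃ h₁ h₂ he₃ c a (by omega); omega
  · have := burnside_ordered h₂ h₁ h₃ he₂ a c (by omega); omega
  · have := burnside_ordered h₂ h₃ h₁ he₂ b c (by omega); omega
  · have := burnside_ordered h₃ h₂ h₁ he₃ b a (by omega); omega
  · have := burnside_ordered h₃ h₂ h₁ he₃ b a (by omega); omega

/-- The orbit equation `∑ mᵢ + 2 (n - 1) = r n`, for `r` orbits of sizes `mᵢ` with nontrivial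
stabilizers of orders `eᵢ` in a group of order `n`, has `r ≤ 3` because `2 mᵢ ≤ n`. -/
theorem burnside_numeric {ι : Type*} [Fintype ι] {n : ℕ} (hn : 2 ≤ n) (m e : ι → ℕ)
    (hme : ∀ i, m i * e i = n) (he : ∀ i, 2 ≤ e i)
    (hs : ∑ i, m i + 2 * (n - 1) = Fintype.card ι * n) :
    (∃ i, m i ≤ 2) ∨ n = 12 ∨ (n = 24 ∧ ∃ i, e i = 4) ∨ n = 60 := by
  have hle : (∑ i, m i) * 2 ≤ Fintype.card ι * n := by
    rw [Finset.sum_mul]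
    calc ∑ i, m i * 2 ≤ ∑ _i : ι, n := Finset.sum_le_sum fun i _ => by
          rw [← hme i]; exact Nat.mul_le_mul_left _ (he i)
      _ = _ := by simp
  obtain ⟨k, ⟨σ⟩⟩ : ∃ k, Nonempty (Fin k ≃ ι) := ⟨_, ⟨(Fintype.equivFin ι).symm⟩⟩
  rw [← Fintype.card_congr σ, Fintype.card_fin] at hs hle
  rw [← σ.sum_comp] at hs hle
  have hk : k < 4 := by
    by_contra h
    have : 4 * n ≤ k * n := Nat.mul_le_mul_right _ (by omega)
    omega
  interval_cases k
  · simp at hs; omega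
  · simp at hs; exact Or.inl ⟨σ 0, by omega⟩
  · simp [Fin.sum_univ_two] at hs; exact Or.inl ⟨σ 0, by omega⟩
  · simp only [Fin.sum_univ_three] at hs
    rcases burnside_three (hme (σ 0)) (hme (σ 1)) (hme (σ 2)) (he _) (he _) (he _) (by omega) with
      (h | h | h) | h | ⟨h, h' | h' | h'⟩ | h
    · exact Or.inl ⟨_, h⟩
    · exact Or.inl ⟨_, h⟩
    · exact Or.inl ⟨_, h⟩
    · exact Or.inr (Or.inl h)
    · exact Or.inr (Or.inr (Or.inl ⟨h, _, h'⟩))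
    · exact Or.inr (Or.inr (Or.inl ⟨h, _, h'⟩))
    · exact Or.inr (Or.inr (Or.inl ⟨h, _, h'⟩))
    · exact Or.inr (Or.inr (Or.inr h))

open MulAction in
/-- A finite group acting so that every nontrivial element has exactly two fixed points has a point
stabilizer of index at most `2`, or order `12`, `24` or `60`, as for finite rotation groups:
Burnside's count is applied to the points with nontrivial stabilizer. -/
theorem exists_stabilizer_index_le_two {Γ Ω : Type*} [Group Γ] [Finite Γ] [MulAction Γ Ω]
    [Nonempty Ω] (h : ∀ g : Γ, g ≠ 1 → (fixedBy Ω g).ncard = 2) :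
    (∃ x : Ω, (stabilizer Γ x).index ≤ 2) ∨ Nat.card Γ = 12 ∨
      (Nat.card Γ = 24 ∧ ∃ x : Ω, Nat.card (stabilizer Γ x) = 4) ∨ Nat.card Γ = 60 := by
  classical
  rcases subsingleton_or_nontrivial Γ with hΓ | hΓ
  · left
    obtain ⟨x⟩ := ‹Nonempty Ω›
    refine ⟨x, ?_⟩
    rw [Subsingleton.elim (stabilizer Γ x) ⊤, Subgroup.index_top]
    omega
  have := Fintype.ofFinite Γ
  -- The set of points with nontrivial stabilizer, as a `Γ`-set.
  let X : SubMulAction Γ Ω :=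
    { carrier := {x | stabilizer Γ x ≠ ⊥}
      smul_mem' := fun g x hx => by
        rw [Set.mem_ofPred_eq, stabilizer_smul_eq_stabilizer_map_conj]
        intro h0
        rw [Subgroup.map_eq_bot_iff_of_injective _ (MulEquiv.injective _)] at h0
        exact hx h0 }
  have hmem : ∀ x, x ∈ X ↔ ∃ g : Γ, g ≠ 1 ∧ x ∈ fixedBy Ω g := fun x => by
    change stabilizer Γ x ≠ ⊥ ↔ _
    rw [Subgroup.ne_bot_iff_exists_ne_one]
    constructor
    · rintro ⟨⟨g, hg⟩, hg1⟩
      exact ⟨g, fun hh => hg1 (Subtype.ext hh), hg⟩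
    · rintro ⟨g, hg1, hg⟩
      exact ⟨⟨g, hg⟩, fun hh => hg1 (congrArg Subtype.val hh)⟩
  have hXfin : (X : Set Ω).Finite := by
    have : (X : Set Ω) ⊆ ⋃ g ∈ {g : Γ | g ≠ 1}, fixedBy Ω g := fun x hx => by
      obtain ⟨g, h1, h2⟩ := (hmem x).1 hx
      simp only [Set.mem_iUnion]
      exact ⟨g, h1, h2⟩
    refine Set.Finite.subset (Set.Finite.biUnion (Set.toFinite _) fun g hg => ?_) this
    exact Set.finite_of_ncard_ne_zero (by rw [h g hg]; omega)
  have : Finite X := hXfin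
  have := Fintype.ofFinite X
  have := Fintype.ofFinite (Quotient (orbitRel Γ X))
  have hfix : ∀ g : Γ, g ≠ 1 → Fintype.card (fixedBy X g) = 2 := fun g hg => by
    rw [← h g hg, ← Nat.card_coe_set_eq, ← Nat.card_eq_fintype_card]
    refine Nat.card_congr ⟨fun x => ⟨x.1.1, congrArg Subtype.val x.2⟩,
      fun x => ⟨⟨x.1, (hmem _).2 ⟨g, hg, x.2⟩⟩, Subtype.ext x.2⟩, fun _ => rfl, fun _ => rfl⟩
  have hb := sum_card_fixedBy_eq_card_orbits_mul_card_group Γ X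
  rw [← Finset.add_sum_erase _ _ (Finset.mem_univ (1 : Γ)),
    Finset.sum_congr rfl (fun g hg => hfix g (Finset.ne_of_mem_erase hg)), Finset.sum_const,
    Finset.card_erase_of_mem (Finset.mem_univ _), Finset.card_univ] at hb
  have h1 : Fintype.card (fixedBy X (1 : Γ)) = Fintype.card X := by
    simp
  rw [h1, Fintype.card_congr (selfEquivSigmaOrbits' Γ X), Fintype.card_sigma, smul_eq_mul,
    mul_comm _ 2] at hb
  have hn : 2 ≤ Fintype.card Γ := Fintype.one_lt_card
  have horb : ∀ q : Quotient (orbitRel Γ X), Fintype.card (orbitRel.Quotient.orbit q) =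
      (stabilizer Γ (q.out : Ω)).index := fun q => by
    have hst : stabilizer Γ (q.out : Ω) = stabilizer Γ q.out := by
      ext g; simp [mem_stabilizer_iff, Subtype.ext_iff]
    rw [hst, index_stabilizer, ← Nat.card_eq_fintype_card, ← Nat.card_coe_set_eq,
      orbitRel.Quotient.orbit_eq_orbit_out q Quotient.out_eq']
  have key := burnside_numeric hn
    (fun q : Quotient (orbitRel Γ X) => Fintype.card (orbitRel.Quotient.orbit q))
    (fun q => Nat.card (stabilizer Γ (q.out : Ω)))
    (fun q => by
      rw [horb, Subgroup.index_mul_card, Nat.card_eq_fintype_card])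
    (fun q => by
      have : Nontrivial (stabilizer Γ (q.out : Ω)) :=
        (Subgroup.nontrivial_iff_ne_bot _).2 q.out.2
      exact Finite.one_lt_card)
    hb
  rw [Nat.card_eq_fintype_card]
  rcases key with ⟨q, hq⟩ | hq | ⟨hq, q, hq'⟩ | hq
  · exact Or.inl ⟨_, (horb q) ▸ hq⟩
  · exact Or.inr (Or.inl hq)
  · exact Or.inr (Or.inr (Or.inl ⟨hq, _, hq'⟩))
  · exact Or.inr (Or.inr (Or.inr hq))

section

open Matrix Matrix.ProjGenLinGroup OnePoint
open scoped MatrixGroups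

/-! ### Elements of `PGL₂(K)` as matrices up to scalars -/

theorem isParabolic_iff_entries {K : Type*} [Field K] (A : GL (Fin 2) K) :
    A.IsParabolic ↔ ¬ (A 0 1 = 0 ∧ A 1 0 = 0 ∧ A 0 0 = A 1 1) ∧
      (A 0 0 - A 1 1) ^ 2 + 4 * (A 0 1 * A 1 0) = 0 := by
  have h1 : A.val ∈ Set.range (Matrix.scalar (Fin 2)) ↔
      (A 0 1 = 0 ∧ A 1 0 = 0 ∧ A 0 0 = A 1 1) := by
    constructor
    · rintro ⟨a, ha⟩
      simp [← ha]
    · rintro ⟨hb, hc, hd⟩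
      refine ⟨A 0 0, ?_⟩
      ext i j
      fin_cases i <;> fin_cases j <;> simp [hb, hc, hd]
  have h2 : A.val.discr = (A 0 0 - A 1 1) ^ 2 + 4 * (A 0 1 * A 1 0) := by
    rw [discr_fin_two, trace_fin_two, det_fin_two]; ring
  rw [GeneralLinearGroup.IsParabolic, Matrix.IsParabolic, h1, h2]

theorem mk_eq_one_iff_entries {K : Type*} [Field K] (A : GL (Fin 2) K) :
    mk A = 1 ↔ A 0 1 = 0 ∧ A 1 0 = 0 ∧ A 0 0 = A 1 1 := by
  rw [mk_eq_one, GeneralLinearGroup.mem_center_iff_val_mem_range_scalar]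
  constructor
  · rintro ⟨a, ha⟩
    simp [← ha]
  · rintro ⟨hb, hc, hd⟩
    refine ⟨A 0 0, ?_⟩
    ext i j
    fin_cases i <;> fin_cases j <;> simp [hb, hc, hd]

theorem mk_eq_mk_iff_entries {K : Type*} [Field K] {A B : GL (Fin 2) K} :
    mk A = mk B ↔ ∃ u : Kˣ, ∀ i j, B i j = u * A i j := by
  rw [mk_eq_mk_iff]
  refine exists_congr fun u => ?_
  rw [Units.ext_iff, ← Matrix.ext_iff]
  refine forall_congr' fun i => forall_congr' fun j => ?_
  simp [mul_comm, eq_comm]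

/-- Being parabolic is invariant under multiplication by scalars. -/
theorem isParabolic_congr {K : Type*} [Field K] {A B : GL (Fin 2) K} (h : mk A = mk B) :
    A.IsParabolic ↔ B.IsParabolic := by
  obtain ⟨u, hu⟩ := mk_eq_mk_iff_entries.1 h
  have hu0 := u.ne_zero
  rw [isParabolic_iff_entries, isParabolic_iff_entries]
  simp only [hu]
  simp only [mul_eq_zero, hu0, false_or, mul_right_inj' hu0]
  refine and_congr_right fun _ => ?_
  rw [show ((u : K) * A 0 0 - u * A 1 1) ^ 2 + 4 * (u * A 0 1 * (u * A 1 0)) =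
    u ^ 2 * ((A 0 0 - A 1 1) ^ 2 + 4 * (A 0 1 * A 1 0)) by ring]
  simp [hu0]

theorem isParabolic_map {K L : Type*} [Field K] [Field L] (f : K →+* L) (A : GL (Fin 2) K) :
    (A.map f).IsParabolic ↔ A.IsParabolic := by
  rw [isParabolic_iff_entries, isParabolic_iff_entries]
  simp only [GeneralLinearGroup.map_apply, map_eq_zero, f.injective.eq_iff]
  rw [show (f (A 0 0) - f (A 1 1)) ^ 2 + 4 * (f (A 0 1) * f (A 1 0)) =
    f ((A 0 0 - A 1 1) ^ 2 + 4 * (A 0 1 * A 1 0)) by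
      simp only [map_add, map_pow, map_sub, map_mul, map_ofNat], map_eq_zero]

theorem det_entries_ne_zero {K : Type*} [Field K] (A : GL (Fin 2) K) :
    A 0 0 * A 1 1 - A 0 1 * A 1 0 ≠ 0 := by
  rw [← det_fin_two]; exact A.det_ne_zero

/-! ### The subgroup `PSL₂(K)` of `PGL₂(K)` -/

/-- The subgroup `PSL₂(K)` of `PGL₂(K)`, as the image of `SL₂(K)`. -/
def pslSubgroup (K : Type*) [Field K] : Subgroup PGL(2, K) :=
  (SpecialLinearGroup.toPGL (n := Fin 2) (R := K)).range

theorem mk_mem_pslSubgroup_iff {K : Type*} [Field K] (A : GL (Fin 2) K) :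
    mk A ∈ pslSubgroup K ↔ IsSquare A.val.det := by
  constructor
  · rintro ⟨s, hs⟩
    obtain ⟨u, rfl⟩ := mk_eq_mk_iff.1 hs
    refine ⟨u, ?_⟩
    rw [Units.val_mul, det_mul]
    simp [s.2, sq]
  · rintro ⟨c, hc⟩
    have hc0 : c ≠ 0 := by
      rintro rfl
      exact A.det_ne_zero (by simpa using hc)
    refine ⟨⟨c⁻¹ • A.val, ?_⟩, ?_⟩
    · rw [det_smul, hc]; simp; field_simp
    · refine mk_eq_mk_iff_entries.2 ⟨Units.mk0 c hc0, fun i j => ?_⟩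
      change A i j = c * (c⁻¹ * A i j)
      field_simp

instance pslSubgroup_normal (K : Type*) [Field K] : (pslSubgroup K).Normal := by
  refine ⟨fun n hn g => ?_⟩
  induction n using ProjGenLinGroup.induction_on with | mk N =>
  induction g using ProjGenLinGroup.induction_on with | mk A =>
  rw [← map_inv, ← map_mul, ← map_mul, mk_mem_pslSubgroup_iff]
  rw [mk_mem_pslSubgroup_iff] at hn
  simpa [det_mul, mul_right_comm _ N.val.det, A.det_ne_zero] using hn

/-- A product of two non-squares of a finite field is a square, so `PSL₂(K)` has index `2` in every
group not contained in it. -/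
theorem pslSubgroup_relIndex {K : Type*} [Field K] [Finite K]
    {M : Subgroup PGL(2, K)} (hM : ¬ M ≤ pslSubgroup K) : (pslSubgroup K).relIndex M = 2 := by
  classical
  have := Fintype.ofFinite K
  obtain ⟨a, haM, haS⟩ := SetLike.not_le_iff_exists.1 hM
  rw [Subgroup.relIndex_eq_two_iff]
  refine ⟨a, haM, fun b _ => ?_⟩
  by_cases hb : b ∈ pslSubgroup K
  · exact Or.inr ⟨hb, fun h => haS (((pslSubgroup K).mul_mem_cancel_left hb).1 h)⟩
  · refine Or.inl ⟨?_, hb⟩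
    induction a using ProjGenLinGroup.induction_on with | mk A =>
    induction b using ProjGenLinGroup.induction_on with | mk B =>
    rw [mk_mem_pslSubgroup_iff] at haS hb
    rw [← map_mul, mk_mem_pslSubgroup_iff, Units.val_mul, det_mul]
    rw [← quadraticChar_neg_one_iff_not_isSquare] at haS hb
    rw [← quadraticChar_one_iff_isSquare (mul_ne_zero B.det_ne_zero A.det_ne_zero), map_mul, haS,
      hb]
    rfl

theorem exists_lowerUnitriangular {K : Type*} [Field K] (t : K) :
    ∃ L : GL (Fin 2) K, L.val = !![1, 0; t, 1] :=
  ⟨⟨!![1, 0; t, 1], !![1, 0; -t, 1], by simp [one_fin_two], by simp [one_fin_two]⟩, rfl⟩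

theorem eq_one_of_commute_pslSubgroup {K : Type*} [Field K] (g : PGL(2, K))
    (h : ∀ s ∈ pslSubgroup K, g * s = s * g) : g = 1 := by
  induction g using ProjGenLinGroup.induction_on with | mk A =>
  have hU := h (mk (GeneralLinearGroup.upperRightHom 1))
    ((mk_mem_pslSubgroup_iff _).2 (by simp))
  obtain ⟨L, hLval⟩ := exists_lowerUnitriangular (1 : K)
  have hL := h (mk L) ((mk_mem_pslSubgroup_iff _).2 (by simp [hLval]))
  rw [← map_mul, ← map_mul] at hU hL
  obtain ⟨u, hu⟩ := mk_eq_mk_iff_entries.1 hU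
  obtain ⟨v, hv⟩ := mk_eq_mk_iff_entries.1 hL
  have hu0 := u.ne_zero
  have hv0 := v.ne_zero
  have hdet := det_entries_ne_zero A
  simp [Matrix.mul_apply, Fin.forall_fin_two, hLval] at hu hv
  rw [mk_eq_one_iff_entries]
  have c0 : A 1 0 = 0 := by grind
  have b0 : A 0 1 = 0 := by grind
  refine ⟨b0, c0, ?_⟩
  grind

/-- Nontrivial normal subgroups of `PGL₂(K)` contain `PSL₂(K)`: they meet the simple group `PSL₂(K)`
nontrivially because its centralizer is trivial. -/
theorem pslSubgroup_le_of_normal {K : Type*} [Field K] (hK : ∃ a : K, a ≠ 0 ∧ a ^ 2 ≠ 1)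
    {N : Subgroup PGL(2, K)} (hN : N.Normal) (hne : N ≠ ⊥) : pslSubgroup K ≤ N := by
  have := ProjectiveSpecialLinearGroup.rank_two_simple' hK
  rcases (hN.comap ProjectiveSpecialLinearGroup.toPGL).eq_bot_or_eq_top with h | h
  · refine absurd ((Subgroup.eq_bot_iff_forall _).2 fun g hg => ?_) hne
    -- `N` meets `PSL₂(K)` trivially, so commutators of `N` and `PSL₂(K)` vanish.
    refine eq_one_of_commute_pslSubgroup g ?_
    rintro s ⟨s, rfl⟩
    have hc : g * SpecialLinearGroup.toPGL s * g⁻¹ * (SpecialLinearGroup.toPGL s)⁻¹ ∈ N := by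
      rw [mul_assoc, mul_assoc]
      refine N.mul_mem hg ?_
      rw [← mul_assoc]
      exact hN.conj_mem _ (N.inv_mem hg) _
    obtain ⟨r, hr⟩ : g * SpecialLinearGroup.toPGL s * g⁻¹ * (SpecialLinearGroup.toPGL s)⁻¹ ∈
        pslSubgroup K :=
      (pslSubgroup K).mul_mem ((pslSubgroup_normal K).conj_mem _ ⟨s, rfl⟩ _)
        ((pslSubgroup K).inv_mem ⟨s, rfl⟩)
    have hr1 : (r : ProjectiveSpecialLinearGroup (Fin 2) K) = 1 := by
      rw [← Subgroup.mem_bot, ← h, Subgroup.mem_comap]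
      change SpecialLinearGroup.toPGL r ∈ N
      rw [hr]
      exact hc
    have : SpecialLinearGroup.toPGL r = 1 := by
      change ProjectiveSpecialLinearGroup.toPGL (r : ProjectiveSpecialLinearGroup (Fin 2) K) = 1
      rw [hr1, map_one]
    rw [this] at hr
    rw [← mul_inv_eq_one, _root_.mul_inv_rev, ← mul_assoc]
    exact hr.symm
  · rintro _ ⟨s, rfl⟩
    have : (s : ProjectiveSpecialLinearGroup (Fin 2) K) ∈
      N.comap ProjectiveSpecialLinearGroup.toPGL := by rw [h]; trivial
    exact this

theorem not_isSolvable_pgl {K : Type*} [Field K] (hK : ∃ a : K, a ≠ 0 ∧ a ^ 2 ≠ 1) :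
    ¬ Group.IsSolvable PGL(2, K) := by
  intro h
  have : Group.IsSolvable PSL(2, K) :=
    Group.isSolvable_of_isSolvable_injective ProjectiveSpecialLinearGroup.toPGL_injective
  exact (Group.IsSolvable.commutator_lt_top_of_nontrivial PSL(2, K)).ne
    (SL2Simple.PSL_commutator_eq_top hK)

/-- If `2` is a square, elements of order `4` of `PGL₂(K)` lie in `PSL₂(K)`: for a representing
matrix `A` of trace `t` and determinant `d`, since `A ^ 4` is scalar and `A ^ 2` is not,
`t ^ 2 = 2 * d`. -/
theorem mem_pslSubgroup_of_orderOf_eq_four {K : Type*} [Field K] (h2 : IsSquare (2 : K))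
    {g : PGL(2, K)} (hg : orderOf g = 4) : g ∈ pslSubgroup K := by
  have h4 : g ^ 4 = 1 := hg ▸ pow_orderOf_eq_one g
  have hg2 : g ^ 2 ≠ 1 := pow_ne_one_of_lt_orderOf (by norm_num) (by omega)
  induction g using ProjGenLinGroup.induction_on with | mk A =>
  rw [← map_pow, mk_eq_one_iff_entries] at h4
  rw [← map_pow, Ne, mk_eq_one_iff_entries] at hg2
  rw [mk_mem_pslSubgroup_iff, det_fin_two]
  simp only [pow_succ, pow_zero, one_mul, Units.val_mul, Matrix.mul_apply, Fin.sum_univ_two]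
    at h4 hg2
  obtain ⟨s, hs⟩ := h2
  have ht : A 0 0 + A 1 1 ≠ 0 := by
    intro ht
    apply hg2
    have : A 1 1 = - A 0 0 := by linear_combination ht
    rw [this]
    refine ⟨by ring, by ring, by ring⟩
  -- By Cayley–Hamilton, `A ^ 4` is `t * (t ^ 2 - 2 * d)` times `A` plus a scalar.
  have key : (A 0 0 + A 1 1) ^ 2 = 2 * (A 0 0 * A 1 1 - A 0 1 * A 1 0) := by
    by_contra hne
    have hne' := mul_ne_zero ht (sub_ne_zero.2 hne)
    obtain ⟨p1, p2, p3⟩ := h4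
    have hb : A 0 1 = 0 := (mul_eq_zero.1 (show A 0 1 * ((A 0 0 + A 1 1) * ((A 0 0 + A 1 1) ^ 2 -
      2 * (A 0 0 * A 1 1 - A 0 1 * A 1 0))) = 0 by linear_combination p1)).resolve_right hne'
    have hc : A 1 0 = 0 := (mul_eq_zero.1 (show A 1 0 * ((A 0 0 + A 1 1) * ((A 0 0 + A 1 1) ^ 2 -
      2 * (A 0 0 * A 1 1 - A 0 1 * A 1 0))) = 0 by linear_combination p2)).resolve_right hne'
    have hd : A 0 0 - A 1 1 = 0 := (mul_eq_zero.1 (show (A 0 0 - A 1 1) * ((A 0 0 + A 1 1) *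
      ((A 0 0 + A 1 1) ^ 2 - 2 * (A 0 0 * A 1 1 - A 0 1 * A 1 0))) = 0 by
        linear_combination p3)).resolve_right hne'
    apply hg2
    rw [hb, hc, sub_eq_zero.1 hd]
    simp
  have hs0 : s ≠ 0 := by
    rintro rfl
    rw [hs] at key
    exact ht (by simpa using key)
  -- The determinant is `(t / s) ^ 2`, where `s ^ 2 = 2`.
  refine ⟨(A 0 0 + A 1 1) / s, ?_⟩
  rw [hs] at key
  field_simp
  linear_combination -key

/-! ### The action on the projective line -/

/-- `PGL₂(K)` acts on `ℙ¹(K) = K ∪ {∞}` by Möbius transformations. -/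
noncomputable instance pglMulAction {K : Type*} [Field K] [DecidableEq K] :
    MulAction PGL(2, K) (OnePoint K) :=
  mulActionOfGL fun u x => by
    cases x with
    | infty => simp [smul_infty_eq_ite]
    | coe x => simp [smul_some_eq_ite]

theorem pgl_mk_smul {K : Type*} [Field K] [DecidableEq K] (A : GL (Fin 2) K) (x : OnePoint K) :
    mk A • x = A • x := rfl

theorem exists_smul_infty_smul_zero {K : Type*} [Field K] [DecidableEq K] {x y : OnePoint K}
    (h : x ≠ y) :
    ∃ A : GL (Fin 2) K, A • (∞ : OnePoint K) = x ∧ A • ((0 : K) : OnePoint K) = y := by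
  cases x with
  | infty =>
    cases y with
    | infty => exact absurd rfl h
    | coe y =>
      refine ⟨GeneralLinearGroup.upperRightHom y, ?_, ?_⟩
      · simp [smul_infty_eq_ite]
      · simp [smul_some_eq_ite]
  | coe x =>
    cases y with
    | infty =>
      refine ⟨GeneralLinearGroup.mkOfDetNeZero !![x, 1; 1, 0] (by simp), ?_, ?_⟩
      · simp [smul_infty_eq_ite, GeneralLinearGroup.mkOfDetNeZero]
      · simp [smul_some_eq_ite, GeneralLinearGroup.mkOfDetNeZero]
    | coe y =>
      have hxy : x - y ≠ 0 := fun h0 => h (by rw [sub_eq_zero.1 h0])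
      refine ⟨GeneralLinearGroup.mkOfDetNeZero !![x, y; 1, 1] (by simpa using hxy), ?_, ?_⟩
      · simp [smul_infty_eq_ite, GeneralLinearGroup.mkOfDetNeZero]
      · simp [smul_some_eq_ite, GeneralLinearGroup.mkOfDetNeZero]

theorem exists_smul_infty {K : Type*} [Field K] [DecidableEq K] (x : OnePoint K) :
    ∃ A : GL (Fin 2) K, A • (∞ : OnePoint K) = x := by
  rcases eq_or_ne x ∞ with rfl | hx
  · exact ⟨1, one_smul _ _⟩
  · obtain ⟨A, hA, -⟩ := exists_smul_infty_smul_zero hx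
    exact ⟨A, hA⟩

/-- Over an algebraically closed field, a matrix that is neither scalar nor parabolic has two
distinct eigenlines. -/
theorem ncard_fixedBy_eq_two {K : Type*} [Field K] [IsAlgClosed K] [NeZero (2 : K)] [DecidableEq K]
    (A : GL (Fin 2) K) (h1 : mk A ≠ 1) (hp : ¬ A.IsParabolic) :
    {x : OnePoint K | A • x = x}.ncard = 2 := by
  rw [Ne, mk_eq_one_iff_entries] at h1
  rw [isParabolic_iff_entries, not_and] at hp
  have hd := hp h1
  have hdet := det_entries_ne_zero A
  rw [Set.ncard_eq_two]
  by_cases hc : A 1 0 = 0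
  · have hne : A 1 1 - A 0 0 ≠ 0 := fun h => hd (by rw [hc]; linear_combination (A 1 1 - A 0 0) * h)
    have hd1 : A 1 1 ≠ 0 := fun h => hdet (by rw [hc, h]; ring)
    refine ⟨∞, ((A 0 1 / (A 1 1 - A 0 0) : K) : OnePoint K), infty_ne_coe _, ?_⟩
    ext x
    cases x with
    | infty => simp [smul_infty_eq_ite, hc]
    | coe x =>
      simp only [Set.mem_ofPred_eq, smul_some_eq_ite, hc, zero_mul, zero_add, hd1, if_false,
        coe_eq_coe, Set.mem_insert_iff, Set.mem_singleton_iff, coe_ne_infty, false_or]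
      rw [div_eq_iff hd1, eq_div_iff hne]
      constructor <;> intro h <;> linear_combination -h
  · obtain ⟨s, hs⟩ := IsAlgClosed.exists_eq_mul_self
      (discrim (A 1 0) (A 1 1 - A 0 0) (-A 0 1))
    have hs0 : s ≠ 0 := by
      rintro rfl
      apply hd
      rw [discrim] at hs
      linear_combination hs
    have h2 : (2 : K) ≠ 0 := NeZero.ne _
    refine ⟨(((-(A 1 1 - A 0 0) + s) / (2 * A 1 0) : K) : OnePoint K),
      (((-(A 1 1 - A 0 0) - s) / (2 * A 1 0) : K) : OnePoint K), ?_, ?_⟩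
    · rw [Ne, coe_eq_coe, div_left_inj' (mul_ne_zero h2 hc)]
      intro h
      exact mul_ne_zero h2 hs0 (by linear_combination h)
    · ext x
      cases x with
      | infty => simp [smul_infty_eq_ite, hc]
      | coe x =>
        simp only [Set.mem_ofPred_eq, Set.mem_insert_iff, Set.mem_singleton_iff, coe_eq_coe]
        rw [← GeneralLinearGroup.fixpointPolynomial_aeval_eq_zero_iff,
          ← quadratic_eq_zero_iff hc hs]
        simp [GeneralLinearGroup.fixpointPolynomial, sq, sub_eq_add_neg]

/-- The ratio of the diagonal entries of an element of `PGL₂(K)`, computed on a representing matrix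
(`0` if the lower right entry vanishes); it is multiplicative on the stabilizer of `∞`. -/
noncomputable def diagRatio {K : Type*} [Field K] (g : PGL(2, K)) : K :=
  (mk_surjective g).choose 0 0 / (mk_surjective g).choose 1 1

theorem diagRatio_mk {K : Type*} [Field K] (A : GL (Fin 2) K) :
    diagRatio (mk A) = A 0 0 / A 1 1 := by
  obtain ⟨u, hu⟩ := mk_eq_mk_iff_entries.1 (mk_surjective (mk A)).choose_spec
  rw [diagRatio, hu, hu, mul_div_mul_left _ _ u.ne_zero]

/-- The stabilizer of a point of `ℙ¹(K)` maps to `K` by a character whose kernel consists of the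
conjugates of upper unitriangular matrices by a fixed matrix. -/
theorem exists_stabilizer_hom {K : Type*} [Field K] [DecidableEq K] (x : OnePoint K) :
    ∃ (B : GL (Fin 2) K) (χ : MulAction.stabilizer PGL(2, K) x →* K), ∀ g, χ g = 1 →
      ∃ t : K, (g : PGL(2, K)) = mk (B * GeneralLinearGroup.upperRightHom t * B⁻¹) := by
  obtain ⟨B, rfl⟩ := exists_smul_infty x
  have hfix : ∀ g : PGL(2, K), g ∈ MulAction.stabilizer PGL(2, K) (B • (∞ : OnePoint K)) →
      ∃ A : GL (Fin 2) K, mk A = mk B⁻¹ * g * mk B ∧ A 1 0 = 0 ∧ A 0 0 ≠ 0 ∧ A 1 1 ≠ 0 := by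
    intro g hg
    induction g using ProjGenLinGroup.induction_on with | mk A =>
    refine ⟨B⁻¹ * A * B, by simp, ?_⟩
    rw [MulAction.mem_stabilizer_iff, pgl_mk_smul] at hg
    have h0 : (B⁻¹ * A * B) 1 0 = 0 := by
      rw [← smul_infty_eq_self_iff, mul_smul, mul_smul, hg, inv_smul_smul]
    have hdet := det_entries_ne_zero (B⁻¹ * A * B)
    rw [h0, mul_zero, sub_zero] at hdet
    exact ⟨h0, left_ne_zero_of_mul hdet, right_ne_zero_of_mul hdet⟩
  refine ⟨B, ⟨⟨fun g => diagRatio (mk B⁻¹ * (g : PGL(2, K)) * mk B), ?_⟩, ?_⟩, ?_⟩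
  · have : mk B⁻¹ * ((1 : MulAction.stabilizer PGL(2, K) (B • (∞ : OnePoint K))) : PGL(2, K)) *
      mk B = mk (1 : GL (Fin 2) K) := by simp
    rw [this, diagRatio_mk]
    simp
  · rintro ⟨g, hg⟩ ⟨g', hg'⟩
    obtain ⟨A, hA, hA0, -, hA1⟩ := hfix g hg
    obtain ⟨A', hA', hA0', -, hA1'⟩ := hfix g' hg'
    have : mk B⁻¹ * (g * g') * mk B = mk (A * A') := by
      rw [map_mul, hA, hA', map_inv]; group
    change diagRatio (mk B⁻¹ * (g * g') * mk B) = diagRatio (mk B⁻¹ * g * mk B) *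
      diagRatio (mk B⁻¹ * g' * mk B)
    rw [this, ← hA, ← hA', diagRatio_mk, diagRatio_mk, diagRatio_mk]
    simp only [Units.val_mul, Matrix.mul_apply, Fin.sum_univ_two, hA0, hA0', mul_zero, zero_mul,
      add_zero, zero_add]
    field_simp
  · rintro ⟨g, hg⟩ h1
    obtain ⟨A, hA, hA0, -, hA1⟩ := hfix g hg
    change diagRatio (mk B⁻¹ * g * mk B) = 1 at h1
    rw [← hA, diagRatio_mk, div_eq_one_iff_eq hA1] at h1
    refine ⟨A 0 1 / A 1 1, ?_⟩
    have : mk (GeneralLinearGroup.upperRightHom (A 0 1 / A 1 1)) = mk A := by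
      refine mk_eq_mk_iff_entries.2 ⟨Units.mk0 _ hA1, ?_⟩
      simp [Fin.forall_fin_two, hA0, h1]
      field_simp
    rw [map_mul, map_mul, this, hA, map_inv]
    group

/-! ### Subgroups with and without parabolic elements -/

/-- A finite group of non-parabolic Möbius transformations over an algebraically closed field has a
cyclic subgroup of index at most `2` or the order of one of the three polyhedral groups: every
nontrivial element has two fixed points, and point stabilizers embed into the multiplicative group
of the field. -/
theorem finite_pgl_subgroup_cases {K : Type*} [Field K] [IsAlgClosed K] [NeZero (2 : K)]
    {Γ : Type*} [Group Γ] [Finite Γ] (φ : Γ →* PGL(2, K)) (hφ : Function.Injective φ)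
    (hp : ∀ γ A, φ γ = mk A → ¬ A.IsParabolic) :
    (∃ C : Subgroup Γ, IsCyclic C ∧ C.index ≤ 2) ∨ Nat.card Γ = 12 ∨
      (Nat.card Γ = 24 ∧ ∃ γ : Γ, orderOf γ = 4) ∨ Nat.card Γ = 60 := by
  classical
  let : MulAction Γ (OnePoint K) := MulAction.compHom _ φ
  have hcyc : ∀ x : OnePoint K, IsCyclic (MulAction.stabilizer Γ x) := fun x => by
    obtain ⟨B, χ, hχ⟩ := exists_stabilizer_hom x
    let ψ : MulAction.stabilizer Γ x →* MulAction.stabilizer PGL(2, K) x :=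
      (φ.comp (Subgroup.subtype _)).codRestrict _ fun g => g.2
    refine isCyclic_of_injective_ringHom (χ.comp ψ) ?_
    rw [injective_iff_map_eq_one]
    intro g hg
    obtain ⟨t, ht⟩ := hχ _ hg
    have ht0 : t = 0 := by
      by_contra ht0
      refine hp g _ ht ?_
      rw [GeneralLinearGroup.isParabolic_conj_iff, isParabolic_iff_entries]
      simp [ht0]
    refine Subtype.ext (hφ ?_)
    rw [OneMemClass.coe_one, map_one]
    refine ht.trans ?_
    simp [ht0]
  have hfix : ∀ g : Γ, g ≠ 1 → (MulAction.fixedBy (OnePoint K) g).ncard = 2 := fun g hg => by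
    obtain ⟨A, hA⟩ := mk_surjective (φ g)
    have := ncard_fixedBy_eq_two A
      (by rw [hA]; exact fun h => hg (hφ (by rw [h, map_one]))) (hp g A hA.symm)
    rw [← this]
    congr 1
    ext x
    change φ g • x = x ↔ A • x = x
    rw [← hA, pgl_mk_smul]
  rcases exists_stabilizer_index_le_two hfix with ⟨x, hx⟩ | h | ⟨h, x, hx⟩ | h
  · exact Or.inl ⟨_, hcyc x, hx⟩
  · exact Or.inr (Or.inl h)
  · have := hcyc x
    obtain ⟨g, hg⟩ := IsCyclic.exists_generator (α := MulAction.stabilizer Γ x)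
    refine Or.inr (Or.inr (Or.inl ⟨h, g, ?_⟩))
    rw [Subgroup.orderOf_coe, orderOf_eq_card_of_forall_mem_zpowers hg, hx]
  · exact Or.inr (Or.inr (Or.inr h))

/-- The unipotent radical of a Borel subgroup of `PGL₂(p)` is cyclic of order `p`, with cyclic
quotient. -/
theorem isMetacyclic_of_le_stabilizer {p : ℕ} [Fact p.Prime] {x : OnePoint (ZMod p)}
    {H : Subgroup PGL(2, ZMod p)} (hH : H ≤ MulAction.stabilizer PGL(2, ZMod p) x) :
    IsMetacyclic H := by
  obtain ⟨B, χ, hχ⟩ := exists_stabilizer_hom x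
  let f : H →* (ZMod p)ˣ := (χ.comp (Subgroup.inclusion hH)).toHomUnits
  let ψ : Multiplicative (ZMod p) →* PGL(2, ZMod p) :=
    { toFun := fun t => mk (B * GeneralLinearGroup.upperRightHom t.toAdd * B⁻¹)
      map_one' := by simp
      map_mul' := fun s t => by
        rw [← map_mul, toAdd_mul, AddChar.map_add_eq_mul]
        congr 1
        group }
  have : IsCyclic ψ.range := isCyclic_of_surjective ψ.rangeRestrict ψ.rangeRestrict_surjective
  have hker : ∀ g : f.ker, ((g : H) : PGL(2, ZMod p)) ∈ ψ.range := fun g => by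
    obtain ⟨t, ht⟩ := hχ (Subgroup.inclusion hH g) (congrArg Units.val g.2)
    exact ⟨Multiplicative.ofAdd t, ht.symm⟩
  have : IsCyclic f.ker := isCyclic_of_forall_mem (H.subtype.comp f.ker.subtype)
    (H.subtype_injective.comp f.ker.subtype_injective) ψ.range hker
  exact isMetacyclic_of_hom f

/-- A nonzero element generates the additive group of `𝔽_p`, so a subgroup containing one nontrivial
element of a root subgroup contains the whole root subgroup. -/
theorem conj_upperRight_mem_of_mem {p : ℕ} [Fact p.Prime] {M : Subgroup PGL(2, ZMod p)}
    {B : GL (Fin 2) (ZMod p)} {b : ZMod p} (hb : b ≠ 0)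
    (h : mk (B * GeneralLinearGroup.upperRightHom b * B⁻¹) ∈ M) (s : ZMod p) :
    mk (B * GeneralLinearGroup.upperRightHom s * B⁻¹) ∈ M := by
  have : s = (s / b).val • b := by
    rw [nsmul_eq_mul, ZMod.natCast_zmod_val, div_mul_cancel₀ _ hb]
  rw [this, AddChar.map_nsmul_eq_pow, ← conj_pow, map_pow]
  exact M.pow_mem h _

/-- The permutation matrix exchanging the two coordinates, and hence `0` and `∞`. -/
def swapMatrix (K : Type*) [Field K] : GL (Fin 2) K :=
  ⟨!![0, 1; 1, 0], !![0, 1; 1, 0], by simp [one_fin_two], by simp [one_fin_two]⟩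

/-- The upper and lower unitriangular matrices with respect to one basis generate `PSL₂(K)`. -/
theorem pslSubgroup_le_of_conj_mem {K : Type*} [Field K] {M : Subgroup PGL(2, K)}
    (B : GL (Fin 2) K)
    (h1 : ∀ t, mk (B * GeneralLinearGroup.upperRightHom t * B⁻¹) ∈ M)
    (h2 : ∀ t, mk (B * swapMatrix K * GeneralLinearGroup.upperRightHom t *
      (B * swapMatrix K)⁻¹) ∈ M) : pslSubgroup K ≤ M := by
  have key : ∀ s : SL(2, K), mk (B * SpecialLinearGroup.toGL s * B⁻¹) ∈ M := fun s => by
    refine SL2.transvection_induction (fun s => mk (B * SpecialLinearGroup.toGL s * B⁻¹) ∈ M)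
      (fun i j hij c => ?_) (fun s t hs ht => ?_) s
    · fin_cases i <;> fin_cases j
      · exact absurd rfl hij
      · convert h1 c using 4
        ext i j
        fin_cases i <;> fin_cases j <;>
          simp [SpecialLinearGroup.transvection_coe]
      · convert h2 c using 2
        have hsw : SpecialLinearGroup.toGL (SpecialLinearGroup.transvection hij c) *
            swapMatrix K = swapMatrix K * GeneralLinearGroup.upperRightHom c := by
          ext i j
          fin_cases i <;> fin_cases j <;>
            simp [SpecialLinearGroup.transvection_coe, swapMatrix, Matrix.mul_apply]
        rw [mul_assoc B (swapMatrix K), ← hsw]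
        simp [mul_assoc]
      · exact absurd rfl hij
    · have : mk (B * SpecialLinearGroup.toGL (s * t) * B⁻¹) =
          mk (B * SpecialLinearGroup.toGL s * B⁻¹) * mk (B * SpecialLinearGroup.toGL t * B⁻¹) := by
        rw [← map_mul, map_mul SpecialLinearGroup.toGL]
        congr 1
        group
      rw [this]
      exact M.mul_mem hs ht
  intro g hg
  have : (mk B)⁻¹ * g * mk B ∈ pslSubgroup K := by
    simpa using (pslSubgroup_normal K).conj_mem g hg (mk B)⁻¹
  obtain ⟨s, hs⟩ := this
  have hg' : g = mk (B * SpecialLinearGroup.toGL s * B⁻¹) := by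
    rw [map_mul, map_mul, map_inv]
    rw [show mk (SpecialLinearGroup.toGL s) = _ from hs]
    group
  rw [hg']
  exact key s

/-- A parabolic element fixing `x` is, up to scalars, a nontrivial transvection in any basis whose
first vector spans `x`. -/
theorem exists_mk_eq_conj_upperRight {K : Type*} [Field K] [DecidableEq K]
    {A : GL (Fin 2) K} (hA : A.IsParabolic) {x : OnePoint K} (hx : A • x = x) {B : GL (Fin 2) K}
    (hB : B • (∞ : OnePoint K) = x) :
    ∃ t ≠ 0, mk A = mk (B * GeneralLinearGroup.upperRightHom t * B⁻¹) := by
  have hp : (B⁻¹ * A * B).IsParabolic := by simpa using hA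
  have h0 : (B⁻¹ * A * B) 1 0 = 0 := by
    rw [← smul_infty_eq_self_iff, mul_smul, mul_smul, hB, hx, ← hB, inv_smul_smul]
  obtain ⟨had, hb⟩ := (GeneralLinearGroup.isParabolic_iff_of_upperTriangular h0).1 hp
  have hdet := det_entries_ne_zero (B⁻¹ * A * B)
  generalize hC : B⁻¹ * A * B = C at *
  have hd : C 1 1 ≠ 0 := by
    rw [h0, mul_zero, sub_zero] at hdet
    exact right_ne_zero_of_mul hdet
  refine ⟨C 0 1 / C 1 1, div_ne_zero hb hd, ?_⟩
  have : mk (GeneralLinearGroup.upperRightHom (C 0 1 / C 1 1)) = mk C := by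
    refine mk_eq_mk_iff_entries.2 ⟨Units.mk0 _ hd, ?_⟩
    simp [Fin.forall_fin_two, h0, had]
    field_simp
  rw [map_mul, map_mul, this, ← hC, ← map_mul, ← map_mul]
  congr 1
  group

/-- A subgroup of `PGL₂(p)` with a parabolic element that does not fix a point of `ℙ¹(𝔽_p)` contains
two distinct full root subgroups, which generate `PSL₂(p)`. -/
theorem le_stabilizer_or_pslSubgroup_le {p : ℕ} [Fact p.Prime] [NeZero (2 : ZMod p)]
    {M : Subgroup PGL(2, ZMod p)} {A : GL (Fin 2) (ZMod p)} (hA : A.IsParabolic) (hM : mk A ∈ M) :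
    (∃ x : OnePoint (ZMod p), M ≤ MulAction.stabilizer PGL(2, ZMod p) x) ∨
      pslSubgroup (ZMod p) ≤ M := by
  set x := A.parabolicFixedPoint with hxdef
  have hx : A • x = x := hA.smul_eq_self_iff.2 rfl
  by_cases hfix : M ≤ MulAction.stabilizer PGL(2, ZMod p) x
  · exact Or.inl ⟨x, hfix⟩
  right
  obtain ⟨m, hm, hmx⟩ := SetLike.not_le_iff_exists.1 hfix
  induction m using ProjGenLinGroup.induction_on with | mk D =>
  rw [MulAction.mem_stabilizer_iff, pgl_mk_smul] at hmx
  obtain ⟨B, hB, hB0⟩ := exists_smul_infty_smul_zero (Ne.symm hmx)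
  have hB' : (B * swapMatrix (ZMod p)) • (∞ : OnePoint (ZMod p)) = D • x := by
    rw [← hB0, mul_smul]
    congr 1
    simp [swapMatrix, smul_infty_eq_ite]
  have hDA : (D * A * D⁻¹) • D • x = D • x := by
    rw [mul_smul, inv_smul_smul, mul_smul, hx]
  obtain ⟨t, ht, hAt⟩ := exists_mk_eq_conj_upperRight hA hx hB
  obtain ⟨s, hs, hAs⟩ := exists_mk_eq_conj_upperRight
    ((GeneralLinearGroup.isParabolic_conj_iff D A).2 hA) hDA hB'
  refine pslSubgroup_le_of_conj_mem B (conj_upperRight_mem_of_mem ht (hAt ▸ hM))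
    (conj_upperRight_mem_of_mem hs (hAs ▸ ?_))
  rw [map_mul, map_mul, map_inv]
  exact M.mul_mem (M.mul_mem hm hM) (M.inv_mem hm)

/-! ### Maximal subgroups of `PGL₂(p)` -/

theorem pslSubgroup_ne_top {p : ℕ} [Fact p.Prime] [NeZero (2 : ZMod p)] :
    pslSubgroup (ZMod p) ≠ ⊤ := by
  intro h
  have h2 : ringChar (ZMod p) ≠ 2 := by
    intro h2
    exact NeZero.ne (2 : ZMod p) (by simpa using (ringChar.spec (ZMod p) 2).2 (by rw [h2]))
  obtain ⟨a, ha⟩ := FiniteField.exists_nonsquare h2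
  have ha0 : a ≠ 0 := by
    rintro rfl
    exact ha (IsSquare.zero)
  have := h ▸ Subgroup.mem_top
    (mk (GeneralLinearGroup.mkOfDetNeZero !![a, 0; 0, 1] (by simpa using ha0)))
  rw [mk_mem_pslSubgroup_iff] at this
  exact ha (by simpa [GeneralLinearGroup.mkOfDetNeZero] using this)

theorem eq_pslSubgroup_or_eq_top {p : ℕ} [Fact p.Prime] [NeZero (2 : ZMod p)]
    {N : Subgroup PGL(2, ZMod p)} (hN : pslSubgroup (ZMod p) ≤ N) :
    N = pslSubgroup (ZMod p) ∨ N = ⊤ := by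
  by_cases h : N ≤ pslSubgroup (ZMod p)
  · exact Or.inl (le_antisymm h hN)
  · right
    have h1 := Subgroup.relIndex_mul_index hN
    have htop : ¬ (⊤ : Subgroup PGL(2, ZMod p)) ≤ pslSubgroup (ZMod p) := fun h' =>
      pslSubgroup_ne_top (top_le_iff.1 h')
    rw [pslSubgroup_relIndex h, ← Subgroup.relIndex_top_right (pslSubgroup (ZMod p)),
      pslSubgroup_relIndex htop] at h1
    exact Subgroup.index_eq_one.1 (by omega)

/-- If `2` is a square, a subgroup `M` of `PGL₂(p)` incomparable with `PSL₂(p)` meets `PSL₂(p)` in a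
metacyclic group. With a parabolic element, `M` fixes a point of `ℙ¹(𝔽_p)`. Otherwise the orders
`12`, `24`, `60` allowed by `finite_pgl_subgroup_cases` give an intersection of order `6`, of order
`12` with an element of order `4`, or of order `30`, hence a Z-group. -/
theorem isMetacyclic_inf_pslSubgroup {p : ℕ} [Fact p.Prime] [NeZero (2 : ZMod p)]
    (h2 : IsSquare (2 : ZMod p)) {M : Subgroup PGL(2, ZMod p)}
    (hM : ¬ M ≤ pslSubgroup (ZMod p)) (hM' : ¬ pslSubgroup (ZMod p) ≤ M) :
    IsMetacyclic ↥(M ⊓ pslSubgroup (ZMod p)) := by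
  by_cases hpar : ∃ A : GL (Fin 2) (ZMod p), A.IsParabolic ∧ mk A ∈ M
  · obtain ⟨A, hA, hAM⟩ := hpar
    obtain ⟨x, hx⟩ := (le_stabilizer_or_pslSubgroup_le hA hAM).resolve_right hM'
    exact isMetacyclic_of_le_stabilizer (inf_le_left.trans hx)
  have : Finite PGL(2, ZMod p) := Finite.of_surjective mk mk_surjective
  let f := algebraMap (ZMod p) (AlgebraicClosure (ZMod p))
  have : NeZero (2 : AlgebraicClosure (ZMod p)) :=
    ⟨by rw [← map_ofNat f 2, Ne, map_eq_zero]; exact NeZero.ne _⟩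
  have hcard : 2 * Nat.card ↥(M ⊓ pslSubgroup (ZMod p)) = Nat.card M := by
    have h := Subgroup.relIndex_mul_relIndex ⊥ (M ⊓ pslSubgroup (ZMod p)) M bot_le inf_le_left
    rw [Subgroup.inf_relIndex_left, pslSubgroup_relIndex hM, Subgroup.relIndex_bot_left,
      Subgroup.relIndex_bot_left] at h
    omega
  have hinj : Function.Injective ((ProjGenLinGroup.map (n := Fin 2) f).comp M.subtype) := by
    rw [MonoidHom.coe_comp]
    refine Function.Injective.comp ?_ M.subtype_injective
    rw [injective_iff_map_eq_one]
    intro g hg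
    induction g using ProjGenLinGroup.induction_on with | mk A =>
    rw [map_mk, mk_eq_one_iff_entries] at hg
    rw [mk_eq_one_iff_entries]
    simpa only [GeneralLinearGroup.map_apply, map_eq_zero, f.injective.eq_iff] using hg
  have hnp : ∀ γ A, (ProjGenLinGroup.map (n := Fin 2) f).comp M.subtype γ = mk A →
      ¬ A.IsParabolic := by
    rintro ⟨γ, hγ⟩ A hA hAp
    induction γ using ProjGenLinGroup.induction_on with | mk D =>
    refine hpar ⟨D, ?_, hγ⟩
    rw [← isParabolic_map f]
    exact (isParabolic_congr (show mk (D.map f) = mk A from hA)).2 hAp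
  rcases finite_pgl_subgroup_cases _ hinj hnp with
    ⟨C, hC, hi⟩ | h | ⟨h, γ, hγ⟩ | h
  · -- The quotient map `M → M ⧸ C`, restricted to `M ∩ PSL₂(p)`, has cyclic kernel and range.
    have : C.Normal := by
      have := C.index_ne_zero_of_finite
      rcases (show C.index = 1 ∨ C.index = 2 by omega) with h | h
      · rw [Subgroup.index_eq_one.1 h]; infer_instance
      · exact Subgroup.normal_of_index_eq_two h
    have : IsCyclic (M ⧸ C) := by
      rw [Subgroup.index] at hi
      rcases (show Nat.card (M ⧸ C) = 1 ∨ Nat.card (M ⧸ C) = 2 by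
        have : 0 < Nat.card (M ⧸ C) := Nat.card_pos
        omega) with h | h
      · have := (Nat.card_eq_one_iff_unique.1 h).1
        infer_instance
      · exact isCyclic_of_prime_card h
    let g := (QuotientGroup.mk' C).comp (Subgroup.inclusion
      (inf_le_left : M ⊓ pslSubgroup (ZMod p) ≤ M))
    have : IsCyclic g.ker := isCyclic_of_forall_mem ((Subgroup.inclusion
      (inf_le_left : M ⊓ pslSubgroup (ZMod p) ≤ M)).comp g.ker.subtype)
        ((Subgroup.inclusion_injective inf_le_left).comp g.ker.subtype_injective) C
          fun x => (QuotientGroup.eq_one_iff _).1 x.2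
    exact isMetacyclic_of_hom g
  · have : IsZGroup ↥(M ⊓ pslSubgroup (ZMod p)) := .of_squarefree (by
      rw [show Nat.card ↥(M ⊓ pslSubgroup (ZMod p)) = 6 by omega]
      decide +kernel)
    exact isMetacyclic_of_isZGroup
  · -- The element of order `4` lies in `PSL₂(p)`; this excludes `A₄`, which is not metacyclic.
    rw [← Subgroup.orderOf_coe] at hγ
    have : IsZGroup ↥(M ⊓ pslSubgroup (ZMod p)) := isZGroup_of_card_eq_twelve (by omega)
      ⟨γ, γ.2, mem_pslSubgroup_of_orderOf_eq_four h2 hγ⟩ (by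
        rw [← hγ, ← Subgroup.orderOf_coe])
    exact isMetacyclic_of_isZGroup
  · have : IsZGroup ↥(M ⊓ pslSubgroup (ZMod p)) := .of_squarefree (by
      rw [show Nat.card ↥(M ⊓ pslSubgroup (ZMod p)) = 30 by omega]
      decide +kernel)
    exact isMetacyclic_of_isZGroup

/-- The chief factors of `PGL₂(p)` are `PSL₂(p) / 1` and `PGL₂(p) / PSL₂(p)`; so the c-sections of
`M` are trivial if `M = PSL₂(p)`, and are `M ∩ PSL₂(p)` otherwise. -/
theorem secIsSupersolvable_pgl {p : ℕ} [Fact p.Prime] [NeZero (2 : ZMod p)]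
    (hp : ∃ a : ZMod p, a ≠ 0 ∧ a ^ 2 ≠ 1) (h2 : IsSquare (2 : ZMod p))
    {M : Subgroup PGL(2, ZMod p)} (hM : IsCoatom M) : SecIsSupersolvable M := by
  set S := pslSubgroup (ZMod p) with hS
  have hSn : S.Normal := pslSubgroup_normal _
  have hmin : ∀ N : Subgroup PGL(2, ZMod p), N.Normal → N = ⊥ ∨ S ≤ N := fun N hN =>
    or_iff_not_imp_left.2 (pslSubgroup_le_of_normal hp hN)
  have hSbot : S ≠ ⊥ := by
    intro h
    have := (mk_mem_pslSubgroup_iff (K := ZMod p) (GeneralLinearGroup.upperRightHom 1)).2 (by simp)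
    rw [← hS, h, Subgroup.mem_bot, mk_eq_one_iff_entries] at this
    simp at this
  by_cases hSM : S ≤ M
  · obtain rfl : M = S := (eq_pslSubgroup_or_eq_top hSM).resolve_right hM.1
    refine ⟨⟨⊤, S, ⟨inferInstance, hSn, hM.lt_top, fun N _ hN _ => eq_pslSubgroup_or_eq_top hN⟩,
      le_rfl, fun h => hM.1 (top_le_iff.1 h)⟩, ?_⟩
    rintro K L _ ⟨hKL, hL, hK⟩
    have hSK : S ≤ K := (hmin K hKL.normal_top).resolve_left fun h => hK (h ▸ bot_le)
    obtain rfl : L = S := Eq.symm <| (hKL.eq_or_eq S hSn hL hSK).resolve_right fun h => hK h.ge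
    have : Subsingleton (CSection S K S) := by
      rw [CSection, (Subgroup.subgroupOf_eq_top).2 (inf_le_left : S ⊓ K ≤ S)]
      exact QuotientGroup.subsingleton_quotient_top
    exact IsMetacyclic.isSupersolvable ⟨⊥, inferInstance, inferInstance, inferInstance⟩
  · have hMS : ¬ M ≤ S := fun h => by
      rcases h.eq_or_lt with h | h
      · exact hSM h.ge
      · exact pslSubgroup_ne_top (hM.2 S h)
    refine ⟨⟨S, ⊥, ⟨hSn, inferInstance, bot_lt_iff_ne_bot.2 hSbot, fun N hN _ hNS =>
      (hmin N hN).imp_right fun h => le_antisymm hNS h⟩, bot_le, hSM⟩, ?_⟩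
    rintro K L hLn ⟨hKL, hL, hK⟩
    have hSK : S ≤ K := (hmin K hKL.normal_top).resolve_left fun h => hK (h ▸ bot_le)
    have hL0 : L = ⊥ := (hmin L hLn).resolve_right fun h => hSM (h.trans hL)
    obtain rfl : K = S := Eq.symm <| (hKL.eq_or_eq S hSn (hL0 ▸ bot_le) hSK).resolve_left
      fun h => hSbot (h.trans hL0)
    exact ((isMetacyclic_inf_pslSubgroup h2 hMS hSM).of_surjective
      (QuotientGroup.mk' (L.subgroupOf (M ⊓ S))) (QuotientGroup.mk'_surjective _)).isSupersolvable

theorem secIsSupersolvable_pgl_and_not_isSolvable (p : ℕ) [Fact p.Prime]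
    (hp : (p : ℤ) ≡ 1 [ZMOD 8] ∨ (p : ℤ) ≡ -1 [ZMOD 8]) :
    (∀ M : Subgroup PGL(2, ZMod p), IsCoatom M → SecIsSupersolvable M) ∧
      ¬ Group.IsSolvable PGL(2, ZMod p) := by
  have hp8 : p % 8 = 1 ∨ p % 8 = 7 := by
    unfold Int.ModEq at hp
    omega
  have h2 : (2 : ZMod p) ≠ 0 := by
    intro h
    have : p ∣ 2 := (ZMod.natCast_eq_zero_iff 2 p).1 (by exact_mod_cast h)
    have := Nat.le_of_dvd (by norm_num) this
    have := (Fact.out : p.Prime).two_le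
    omega
  have h3 : (3 : ZMod p) ≠ 0 := by
    intro h
    have : p ∣ 3 := (ZMod.natCast_eq_zero_iff 3 p).1 (by exact_mod_cast h)
    have := Nat.le_of_dvd (by norm_num) this
    have := (Fact.out : p.Prime).two_le
    omega
  have : NeZero (2 : ZMod p) := ⟨h2⟩
  have ha : ∃ a : ZMod p, a ≠ 0 ∧ a ^ 2 ≠ 1 :=
    -- `2 ^ 2 = 1` would force `3 = 0`.
    ⟨2, h2, fun h => h3 (by linear_combination h)⟩
  exact ⟨fun M hM => secIsSupersolvable_pgl ha
    ((ZMod.exists_sq_eq_two_iff (by omega)).2 hp8) hM, not_isSolvable_pgl ha⟩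

end

theorem mainTheorem2 :
    (∀ (p : ℕ) [Fact p.Prime], ((p : ℤ) ≡ 1 [ZMOD 8] ∨ (p : ℤ) ≡ -1 [ZMOD 8]) →
      (∀ M : Subgroup (Matrix.ProjGenLinGroup (Fin 2) (ZMod p)), IsCoatom M → SecIsSupersolvable M) ∧
      ¬ Group.IsSolvable (Matrix.ProjGenLinGroup (Fin 2) (ZMod p))) ∧
    ¬ (∀ (G : Type) [Group G] [Finite G],
      (∀ M : Subgroup G, IsCoatom M → SecIsSupersolvable M) → Group.IsSolvable G) := by
  refine ⟨fun p _ hp => secIsSupersolvable_pgl_and_not_isSolvable p hp, fun h => ?_⟩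
  have : Fact (Nat.Prime 7) := ⟨by norm_num⟩
  have : Finite (Matrix.ProjGenLinGroup (Fin 2) (ZMod 7)) :=
    Finite.of_surjective _ Matrix.ProjGenLinGroup.mk_surjective
  obtain ⟨h1, h2⟩ := secIsSupersolvable_pgl_and_not_isSolvable 7 (Or.inr (by decide))
  exact h2 (h _ h1)
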